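/- Let $\mathsf{Sort}:\mathbb{F}_2^4\to\mathbb{F}_2$ be Ambainis's function: $\mathsf{Sort}(x_1,x_2,x_3,x_4)=1$ if $x_1\ge x_2\ge x_3\ge x_4$ or $x_1\le x_2\le x_3\le x_4$, and $0$ otherwise. For Boolean functions $f:\mathbb{F}_2^n\to\mathbb{F}_2$ and $g:\mathbb{F}_2^m\to\mathbb{F}_2$ let $(f\circ g)(y^{(1)},\dots,y^{(n)})=f(g(y^{(1)}),\dots,g(y^{(n)}))$ with $y^{(i)}\in\mathbb{F}_2^m$, and let $f^{\circ 1}=f$, $f^{\circ k}=f\circ f^{\circ (k-1)}$. Let $f_k=\mathsf{Sort}^{\circ k}$, a Boolean function on $n=4^k$ variables. For $f:\mathbb{F}_2^n\to\mathbb{F}_2$ let $\hat f(\alpha)=2^{-n}\sum_{x\in\mathbb{F}_2^n}(-1)^{f(x)}(-1)^{\langle x,\alpha\rangle}$ ($\alpha\in\mathbb{F}_2^n$) be its Fourier coefficients, $\mathsf{sparsity}[\hat f]$ the number of $\alpha$ with $\hat f(\alpha)\ne 0$, and $\lVert\hat f\rVert_1=\sum_\alpha|\hat f(\alpha)|$.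 Let $\mathsf{C}^{\oplus}_{\min}[f]$ be the minimum codimension of a nonempty affine subspace $H\subseteq\mathbb{F}_2^n$ on which $f$ is constant. Then, with absolute constants and for all $k\ge 1$, $$\mathsf{C}^{\oplus}_{\min}[f_k]=\Omega\big((\log_2\mathsf{sparsity}[\hat f_k])^{\log_2 3}\big)\quad\text{and}\quad \mathsf{C}^{\oplus}_{\min}[f_k]=\Omega\big((\log_2\lVert\hat f_k\rVert_1)^{\log_2 3}\big),$$ and the two bounds agree up to constant factors: $(\log_2\mathsf{sparsity}[\hat f_k])^{\log_2 3}=\Theta\big((\log_2\lVert\hat f_k\rVert_1)^{\log_2 3}\big)$. -/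

import Mathlib

namespace BoolPower

/-- The cube `F_2^n`. -/
abbrev Cube (n : ℕ) : Type := Fin n → ZMod 2

/-- Boolean functions `F_2^n → F_2`. -/
abbrev BoolFn (n : ℕ) : Type := Cube n → ZMod 2

/-! ### Composition and powering -/

/-- Composition of Boolean functions: an input `y ∈ F_2^(m * n)` is read as `n` consecutive blocks
`y^(0), …, y^(n-1)` of length `m` (coordinate `a` of block `i` sits at position `m * i + a`), and
`(f ∘ g)(y) = f (g (y^(0)), …, g (y^(n-1)))`. -/
def comp {n m : ℕ} (f : BoolFn n) (g : BoolFn m) : BoolFn (m * n) :=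
  fun y => f fun i => g fun a => y (Fin.cast (Nat.mul_comm n m) (finProdFinEquiv (i, a)))

/-- The `k`-th power of a Boolean function, `f^(k+1) = f ∘ f^k`. The zeroth power is the identity
of `F_2`, so that the first power is `f`. -/
def power {n : ℕ} (f : BoolFn n) : (k : ℕ) → BoolFn (n ^ k)
  | 0 => fun y => y ⟨0, by simp⟩
  | k + 1 => comp f (power f k)

/-! ### The function `Sort` -/

/-- Ambainis's function: `1` if the four input bits are monotone (nonincreasing or nondecreasing),
and `0` otherwise. -/
def sort : BoolFn 4 := fun x =>
  if ((x 0).val ≥ (x 1).val ∧ (x 1).val ≥ (x 2).val ∧ (x 2).val ≥ (x 3).val) ∨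
      ((x 0).val ≤ (x 1).val ∧ (x 1).val ≤ (x 2).val ∧ (x 2).val ≤ (x 3).val)
  then 1 else 0

noncomputable section

/-! ### Fourier analysis -/

/-- The identification of `F_2` with `{1, -1}`, that is `b ↦ (-1)^b`. -/
def sgn (b : ZMod 2) : ℝ := if b = 0 then 1 else -1

/-- The Fourier character `χ_α(x) = (-1)^⟨x, α⟩`. -/
def character {n : ℕ} (α x : Cube n) : ℝ := sgn (x ⬝ᵥ α)

/-- The Fourier coefficient at `α` of a Boolean function viewed with values in `{1, -1}`:
the average over `x` of `(-1)^(f x) * χ_α(x)`. -/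
def fourierCoeff {n : ℕ} (f : BoolFn n) (α : Cube n) : ℝ :=
  (∑ x : Cube n, sgn (f x) * character α x) / 2 ^ n

/-- The Fourier sparsity: the number of nonzero Fourier coefficients. -/
def sparsity {n : ℕ} (f : BoolFn n) : ℕ := {α : Cube n | fourierCoeff f α ≠ 0}.ncard

/-- The spectral `1`-norm: the sum of the absolute values of the Fourier coefficients. -/
def spectralNorm {n : ℕ} (f : BoolFn n) : ℝ := ∑ α : Cube n, |fourierCoeff f α|

/-! ### Parity certificates -/

/-- The codimension of an affine subspace of `F_2^n`. -/
def codim {n : ℕ} (H : AffineSubspace (ZMod 2) (Cube n)) : ℕ :=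
  Module.finrank (ZMod 2) (Cube n ⧸ H.direction)

/-- Parity certificate complexity of `f` at `x`: the least codimension of an affine subspace
through `x` on which `f` is constant. -/
def parityCert {n : ℕ} (f : BoolFn n) (x : Cube n) : ℕ :=
  sInf {d : ℕ | ∃ H : AffineSubspace (ZMod 2) (Cube n),
    x ∈ H ∧ (∀ y ∈ H, f y = f x) ∧ codim H = d}

/-- Minimum parity certificate complexity (parity kill number) of `f`. -/
def minParityCert {n : ℕ} (f : BoolFn n) : ℕ := ⨅ x : Cube n, parityCert f x

end

end BoolPower

/-!
Write `f k` for the `k`-th power of `sort`. Both Fourier quantities can be computed exactly, and the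
certificate bound comes from lifting ordinary certificates to parity certificates.

*Fourier side.* With `s i = (-1)^(x i)` one has
`(-1)^(sort x) = -(s 0 * s 1 + s 1 * s 2 + s 2 * s 3 - s 0 * s 3) / 2`. Substituting functions of
disjoint blocks of variables which have mean zero, the four products have disjoint Fourier supports,
so by induction every Fourier coefficient of `f k` is `0` or `± 2 / 2 ^ 2 ^ k`
(`fourierCoeff_power_sort`). Parseval's identity then gives `log₂ ‖f k‖₁ = 2 ^ k - 1` and
`log₂ sparsity = 2 * (2 ^ k - 1)`.

*Certificate side.* Every variable of `sort` can be made irrelevant by fixing the other three.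
For an inner function `g` with this property, a system of `d` parity constraints on the input of
`F ∘ g` can be satisfied by committing the values of at most `d` blocks while the values of `g` on
all other blocks stay arbitrary (`exists_subcube_of_linear_system`, by induction on the number of
blocks). Hence a parity certificate of `F ∘ g` yields an ordinary certificate of `F` of no larger
size. As ordinary certificates of `f k` have size at least `3 ^ k`, writing
`f (k + 1) = f k ∘ sort` shows that parity certificates of `f (k + 1)` have size at least `3 ^ k`,
and `3 ^ k = (2 ^ k) ^ log₂ 3`.
-/

namespace BoolPower

/-! ### Characters and Parseval's identity -/

theorem zmod_two_cases (a : ZMod 2) : a = 0 ∨ a = 1 := by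
  revert a; decide

@[simp] theorem sgn_zero : sgn 0 = 1 := by simp [sgn]

@[simp] theorem sgn_one : sgn 1 = -1 := by simp [sgn]

theorem sgn_add (a b : ZMod 2) : sgn (a + b) = sgn a * sgn b := by
  have h : (1 + 1 : ZMod 2) = 0 := by decide
  rcases zmod_two_cases a with rfl | rfl <;> rcases zmod_two_cases b with rfl | rfl <;> simp [h]

theorem sgn_mul_self (a : ZMod 2) : sgn a * sgn a = 1 := by
  rcases zmod_two_cases a with rfl | rfl <;> simp

theorem sgn_sum {ι : Type*} (s : Finset ι) (a : ι → ZMod 2) :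
    sgn (∑ i ∈ s, a i) = ∏ i ∈ s, sgn (a i) := by
  classical
  induction s using Finset.induction_on with
  | empty => simp
  | insert i s hi ih => rw [Finset.sum_insert hi, Finset.prod_insert hi, sgn_add, ih]

theorem character_eq_prod {n : ℕ} (α x : Cube n) : character α x = ∏ i, sgn (x i * α i) :=
  sgn_sum _ _

theorem character_comm {n : ℕ} (α x : Cube n) : character α x = character x α := by
  simp [character, dotProduct_comm]

theorem character_add {n : ℕ} (α x y : Cube n) :
    character α (x + y) = character α x * character α y := by
  simp [character, add_dotProduct, sgn_add]

theorem sum_zmod_two (u : ZMod 2 → ℝ) : ∑ a, u a = u 0 + u 1 :=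
  Fin.sum_univ_two u

theorem sum_character {n : ℕ} (α : Cube n) :
    ∑ x, character α x = if α = 0 then (2 : ℝ) ^ n else 0 := by
  have h : ∑ x, character α x = ∏ i, ∑ a : ZMod 2, sgn (a * α i) := by
    rw [Finset.prod_univ_sum, Fintype.piFinset_univ]
    simp only [character_eq_prod]
  rw [h]
  split_ifs with hα
  · simp [hα]
  · obtain ⟨i, hi⟩ := Function.ne_iff.mp hα
    refine Finset.prod_eq_zero (Finset.mem_univ i) ?_
    have hi1 : α i = 1 := (zmod_two_cases _).resolve_left hi
    rw [sum_zmod_two]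
    simp [hi1]

theorem sum_sq_fourierCoeff {n : ℕ} (f : BoolFn n) : ∑ α, fourierCoeff f α ^ 2 = 1 := by
  have hxy (x y : Cube n) : ∑ α, character α x * character α y
      = if x = y then (2 : ℝ) ^ n else 0 := by
    have h0 : x + y = 0 ↔ x = y := by
      constructor
      · intro h
        funext i
        exact (CharTwo.add_eq_zero.mp (congrFun h i))
      · rintro rfl
        funext i
        exact CharTwo.add_self_eq_zero _
    simp_rw [← character_add, character_comm _ (x + y), sum_character, h0]
  have key : ∑ α, (∑ x, sgn (f x) * character α x) ^ 2 = (2 ^ n) ^ 2 := by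
    calc ∑ α, (∑ x, sgn (f x) * character α x) ^ 2
        = ∑ α, ∑ x, ∑ y, sgn (f x) * sgn (f y) * (character α x * character α y) := by
          refine Finset.sum_congr rfl fun α _ => ?_
          rw [sq, Finset.sum_mul_sum]
          refine Finset.sum_congr rfl fun x _ => Finset.sum_congr rfl fun y _ => ?_
          ring
      _ = ∑ x, ∑ y, sgn (f x) * sgn (f y) * ∑ α, character α x * character α y := by
          rw [Finset.sum_comm]
          refine Finset.sum_congr rfl fun x _ => ?_
          rw [Finset.sum_comm]
          refine Finset.sum_congr rfl fun y _ => ?_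
          rw [Finset.mul_sum]
      _ = (2 ^ n) ^ 2 := by
          simp [hxy, sgn_mul_self, sq]
  simp_rw [fourierCoeff, div_pow]
  rw [← Finset.sum_div, key, div_self (by positivity)]

/-! ### Fourier coefficients of the powers of `sort` -/

/-- The position in `Fin (m * n)` of coordinate `a` of block `i`, as used by `comp`. -/
def blockIndex (n m : ℕ) : Fin n × Fin m ≃ Fin (m * n) :=
  finProdFinEquiv.trans (finCongr (Nat.mul_comm n m))

/-- An input of length `m * n` as a tuple of `n` blocks of length `m`. -/
def blocks (n m : ℕ) : Cube (m * n) ≃ (Fin n → Cube m) :=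
  (Equiv.arrowCongr (blockIndex n m).symm (Equiv.refl _)).trans (Equiv.curry _ _ _)

theorem blocks_apply {n m : ℕ} (y : Cube (m * n)) (i : Fin n) (a : Fin m) :
    blocks n m y i a = y (blockIndex n m (i, a)) := rfl

theorem character_blocks {n m : ℕ} (α y : Cube (m * n)) :
    character α y = ∏ i, character (blocks n m α i) (blocks n m y i) := by
  simp_rw [character_eq_prod, blocks_apply]
  rw [← Equiv.prod_comp (blockIndex n m), Fintype.prod_prod_type]

theorem sgn_sort (z : Cube 4) :
    sgn (sort z) = -(sgn (z 0) * sgn (z 1) + sgn (z 1) * sgn (z 2) + sgn (z 2) * sgn (z 3)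
      - sgn (z 0) * sgn (z 3)) / 2 := by
  have h1 : (1 : ZMod 2).val = 1 := rfl
  rcases zmod_two_cases (z 0) with h | h <;> rcases zmod_two_cases (z 1) with h' | h' <;>
  rcases zmod_two_cases (z 2) with h'' | h'' <;> rcases zmod_two_cases (z 3) with h''' | h''' <;>
  norm_num [sort, h, h', h'', h''', h1]

/-- The Fourier expansion of `sort ∘ g`: the quadratic form of `sgn_sort` evaluated on Fourier
coefficients, where a block not occurring in a monomial contributes an indicator of zero frequency. -/
theorem fourierCoeff_comp_sort {m : ℕ} (g : BoolFn m) (α : Cube (m * 4)) (β : Fin 4 → Cube m)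
    (hβ : β = blocks 4 m α) (a δ : Fin 4 → ℝ) (ha : ∀ i, a i = fourierCoeff g (β i))
    (hδ : ∀ i, δ i = if β i = 0 then 1 else 0) :
    fourierCoeff (comp sort g) α
      = -(a 0 * a 1 * δ 2 * δ 3 + δ 0 * a 1 * a 2 * δ 3 + δ 0 * δ 1 * a 2 * a 3
          - a 0 * δ 1 * δ 2 * a 3) / 2 := by
  have hA (i : Fin 4) : ∑ x, sgn (g x) * character (β i) x = 2 ^ m * a i := by
    rw [ha, fourierCoeff]
    field_simp
  have hD (i : Fin 4) : ∑ x, character (β i) x = 2 ^ m * δ i := by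
    rw [sum_character, hδ]
    split_ifs <;> simp
  have hprod (u : Fin 4 → Cube m → ℝ) :
      ∑ y : Fin 4 → Cube m, u 0 (y 0) * u 1 (y 1) * u 2 (y 2) * u 3 (y 3)
        = (∑ x, u 0 x) * (∑ x, u 1 x) * (∑ x, u 2 x) * (∑ x, u 3 x) := by
    have h := Finset.prod_univ_sum (fun _ : Fin 4 => (Finset.univ : Finset (Cube m))) u
    rw [Fintype.piFinset_univ] at h
    simpa only [Fin.prod_univ_four] using h.symm
  let A (i : Fin 4) (x : Cube m) : ℝ := sgn (g x) * character (β i) x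
  let D (i : Fin 4) (x : Cube m) : ℝ := character (β i) x
  have h01 := hprod ![A 0, A 1, D 2, D 3]
  have h12 := hprod ![D 0, A 1, A 2, D 3]
  have h23 := hprod ![D 0, D 1, A 2, A 3]
  have h03 := hprod ![A 0, D 1, D 2, A 3]
  simp only [Matrix.cons_val, A, D, hA, hD] at h01 h12 h23 h03
  have hsum : ∑ x, sgn (comp sort g x) * character α x
      = ∑ y : Fin 4 → Cube m, sgn (sort fun i => g (y i)) * ∏ i, character (β i) (y i) := by
    rw [← Equiv.sum_comp (blocks 4 m)]
    refine Finset.sum_congr rfl fun x _ => ?_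
    rw [character_blocks, hβ]
    rfl
  have hterm (y : Fin 4 → Cube m) :
      sgn (sort fun i => g (y i)) * ∏ i, character (β i) (y i)
        = -(A 0 (y 0) * A 1 (y 1) * D 2 (y 2) * D 3 (y 3)
          + D 0 (y 0) * A 1 (y 1) * A 2 (y 2) * D 3 (y 3)
          + D 0 (y 0) * D 1 (y 1) * A 2 (y 2) * A 3 (y 3)
          - A 0 (y 0) * D 1 (y 1) * D 2 (y 2) * A 3 (y 3)) / 2 := by
    rw [sgn_sort, Fin.prod_univ_four]
    ring
  rw [fourierCoeff, hsum, Finset.sum_congr rfl fun y _ => hterm y, ← Finset.sum_div,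
    Finset.sum_neg_distrib, Finset.sum_sub_distrib, Finset.sum_add_distrib, Finset.sum_add_distrib]
  simp only [A, D]
  rw [h01, h12, h23, h03, pow_mul]
  field_simp

/-- If `g` has mean zero and its nonzero Fourier coefficients all have absolute value `c`, then
`sort ∘ g` has mean zero and nonzero coefficients of absolute value `c ^ 2 / 2`: at each frequency
at most one of the four monomials survives. -/
theorem flat_comp_sort {m : ℕ} {g : BoolFn m} {c : ℝ} (h0 : fourierCoeff g 0 = 0)
    (h : ∀ α, fourierCoeff g α = 0 ∨ |fourierCoeff g α| = c) :
    fourierCoeff (comp sort g) 0 = 0 ∧ ∀ α, fourierCoeff (comp sort g) α = 0 ∨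
      |fourierCoeff (comp sort g) α| = c ^ 2 / 2 := by
  constructor
  · have h0' (i : Fin 4) : (0 : ℝ) = fourierCoeff g (blocks 4 m 0 i) := h0.symm
    rw [fourierCoeff_comp_sort g 0 _ rfl (fun _ => 0) _ h0' fun _ => rfl]
    simp
  · intro α
    obtain ⟨a, ha⟩ : ∃ a : Fin 4 → ℝ, ∀ i, a i = fourierCoeff g (blocks 4 m α i) :=
      ⟨_, fun _ => rfl⟩
    obtain ⟨δ, hδ⟩ : ∃ δ : Fin 4 → ℝ, ∀ i, δ i = if blocks 4 m α i = 0 then 1 else 0 :=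
      ⟨_, fun _ => rfl⟩
    rw [fourierCoeff_comp_sort g α _ rfl a δ ha hδ]
    have hcases (i : Fin 4) : (δ i = 1 ∧ a i = 0) ∨ δ i = 0 := by
      by_cases hi : blocks 4 m α i = 0
      · left
        rw [hδ, ha, hi]
        simpa using h0
      · right
        simp [hδ, hi]
    have hval (i : Fin 4) : a i = 0 ∨ |a i| = c := by
      rw [ha]; exact h _
    have hmul (i j : Fin 4) : a i * a j = 0 ∨ |a i * a j| / 2 = c ^ 2 / 2 := by
      rcases hval i with hi | hi
      · simp [hi]
      rcases hval j with hj | hj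
      · simp [hj]
      · right; rw [abs_mul, hi, hj, sq]
    rcases hcases 0 with ⟨d0, a0⟩ | d0 <;> rcases hcases 1 with ⟨d1, a1⟩ | d1 <;>
    rcases hcases 2 with ⟨d2, a2⟩ | d2 <;> rcases hcases 3 with ⟨d3, a3⟩ | d3 <;>
    simp_all [abs_div]

theorem fourierCoeff_power_zero (α : Cube (4 ^ 0)) :
    fourierCoeff (power sort 0) α = if α = 0 then 0 else 1 := by
  -- `4 ^ 0` is definitionally `1`, and a one-bit input is its only coordinate.
  change Cube 1 at α
  have hsum : ∑ x : Cube 1, sgn (x 0) * character α x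
      = ∑ b : ZMod 2, sgn b * sgn (b * α 0) := by
    rw [← Equiv.sum_comp (Equiv.funUnique (Fin 1) (ZMod 2))]
    refine Finset.sum_congr rfl fun x _ => ?_
    simp [character_eq_prod]
  have hα : α = 0 ↔ α 0 = 0 := by
    constructor
    · intro h; simp [h]
    · intro h; funext i; rw [Subsingleton.elim i 0]; exact h
  change (∑ x : Cube 1, sgn (x 0) * character α x) / 2 ^ 1 = _
  rw [hsum, sum_zmod_two]
  change _ = if α = (0 : Cube 1) then (0 : ℝ) else 1
  simp only [hα]
  rcases zmod_two_cases (α 0) with h | h <;> simp [h]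

theorem fourierCoeff_power_sort (k : ℕ) :
    fourierCoeff (power sort k) 0 = 0 ∧ ∀ α, fourierCoeff (power sort k) α = 0 ∨
      |fourierCoeff (power sort k) α| = 2 / 2 ^ 2 ^ k := by
  induction k with
  | zero =>
    simp only [fourierCoeff_power_zero]
    refine ⟨by simp, fun α => ?_⟩
    split_ifs <;> simp
  | succ k ih =>
    obtain ⟨h1, h2⟩ := flat_comp_sort ih.1 ih.2
    refine ⟨h1, fun α => (h2 α).imp id fun h => ?_⟩
    refine h.trans ?_
    rw [pow_succ 2 k, pow_mul]
    field_simp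

theorem sparsity_eq_card {n : ℕ} (f : BoolFn n) :
    sparsity f = (Finset.univ.filter fun α => fourierCoeff f α ≠ 0).card := by
  rw [sparsity, ← Set.ncard_coe_finset]
  simp

theorem sparsity_spectralNorm_of_flat {n : ℕ} {f : BoolFn n} {c : ℝ} (hc : 0 < c)
    (h : ∀ α, fourierCoeff f α = 0 ∨ |fourierCoeff f α| = c) :
    (sparsity f : ℝ) = c⁻¹ ^ 2 ∧ spectralNorm f = c⁻¹ := by
  have h1 : spectralNorm f = sparsity f * c := by
    rw [spectralNorm, sparsity_eq_card, ← nsmul_eq_mul, ← Finset.sum_const, Finset.sum_filter]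
    refine Finset.sum_congr rfl fun α _ => ?_
    rcases h α with h | h
    · simp [h]
    · rw [if_pos (by rintro h0; simp [h0] at h; linarith), h]
  have h2 : (sparsity f : ℝ) * c ^ 2 = 1 := by
    rw [← sum_sq_fourierCoeff f, sparsity_eq_card, ← nsmul_eq_mul, ← Finset.sum_const,
      Finset.sum_filter]
    refine Finset.sum_congr rfl fun α _ => ?_
    rcases h α with h | h
    · simp [h]
    · rw [if_pos (by rintro h0; simp [h0] at h; linarith), ← h, sq_abs]
  have h3 : (sparsity f : ℝ) = c⁻¹ ^ 2 := by
    field_simp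
    exact h2
  refine ⟨h3, ?_⟩
  rw [h1, h3]
  field_simp

theorem logb_sparsity_spectralNorm (k : ℕ) :
    Real.logb 2 (sparsity (power sort k)) = 2 * (2 ^ k - 1) ∧
      Real.logb 2 (spectralNorm (power sort k)) = 2 ^ k - 1 := by
  obtain ⟨h1, h2⟩ := sparsity_spectralNorm_of_flat (by positivity) (fourierCoeff_power_sort k).2
  have h : Real.logb 2 ((2 / 2 ^ 2 ^ k : ℝ)⁻¹) = 2 ^ k - 1 := by
    rw [inv_div, Real.logb_div (by positivity) two_ne_zero, Real.logb_pow,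
      Real.logb_self_eq_one one_lt_two]
    simp
  rw [h1, h2, Real.logb_pow, h]
  simp

/-! ### Lifting certificates to parity certificates -/

/-- Suppose every variable of `g` can be made irrelevant by fixing the others. Then a solvable linear
system with values in `Q` on the blocks `y i` has solutions for which `g (y i)` is prescribed
outside a fixed set of at most `dim Q` blocks. -/
theorem exists_subcube_of_linear_system {m : ℕ} {g : BoolFn m} (hg : Function.Surjective g)
    (hst : ∀ j, ∃ c : Cube m, ∀ t, g (c + Pi.single j t) = g c) (n : ℕ) (Q : Type)
    [AddCommGroup Q] [Module (ZMod 2) Q] [FiniteDimensional (ZMod 2) Q]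
    (M : Fin n → Cube m →ₗ[ZMod 2] Q) (b : Q) (hb : ∃ y : Fin n → Cube m, ∑ i, M i (y i) = b) :
    ∃ (J : Finset (Fin n)) (z : Cube n), J.card ≤ Module.finrank (ZMod 2) Q ∧
      ∀ w : Cube n, (∀ i ∈ J, w i = z i) →
        ∃ y : Fin n → Cube m, ∑ i, M i (y i) = b ∧ ∀ i, g (y i) = w i := by
  induction n generalizing Q with
  | zero =>
    obtain ⟨y, hy⟩ := hb
    exact ⟨∅, 0, by simp, fun w _ => ⟨y, hy, fun i => i.elim0⟩⟩
  | succ n ih =>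
    by_cases hM : M 0 = 0
    · -- The first block is unconstrained.
      obtain ⟨y, hy⟩ := hb
      obtain ⟨J, z, hJ, h⟩ := ih Q (fun i => M i.succ) b
        ⟨Fin.tail y, by simpa [Fin.sum_univ_succ, hM, Fin.tail] using hy⟩
      refine ⟨J.map (Fin.succEmb n), Fin.cons 0 z, by simpa using hJ, fun w hw => ?_⟩
      obtain ⟨y', hy', hgy'⟩ := h (Fin.tail w) fun i hi => by
        simpa [Fin.tail] using hw i.succ (by simpa using hi)
      obtain ⟨u, hu⟩ := hg (w 0)
      refine ⟨Fin.cons u y', by simpa [Fin.sum_univ_succ, hM] using hy', fun i => ?_⟩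
      refine Fin.cases ?_ (fun i => ?_) i
      · simpa using hu
      · simpa [Fin.tail] using hgy' i
    -- Otherwise the value of `g` on the first block gets committed, at the cost of one dimension.
    suffices ∃ (v : ZMod 2) (J : Finset (Fin n)) (z : Cube n),
        J.card + 1 ≤ Module.finrank (ZMod 2) Q ∧ ∀ w : Cube n, (∀ i ∈ J, w i = z i) →
          ∃ (u : Cube m) (y : Fin n → Cube m), M 0 u + ∑ i : Fin n, M i.succ (y i) = b ∧
            g u = v ∧ ∀ i, g (y i) = w i by
      obtain ⟨v, J, z, hJ, h⟩ := this
      refine ⟨insert 0 (J.map (Fin.succEmb n)), Fin.cons v z,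
        (Finset.card_insert_le _ _).trans (by simpa using hJ), fun w hw => ?_⟩
      obtain ⟨u, y, hy, hu, hgy⟩ := h (Fin.tail w) fun i hi => by
        simpa [Fin.tail] using hw i.succ (by simpa using hi)
      refine ⟨Fin.cons u y, by simpa [Fin.sum_univ_succ] using hy, fun i => ?_⟩
      refine Fin.cases ?_ (fun i => ?_) i
      · simpa [hu] using (hw 0 (by simp)).symm
      · simpa [Fin.tail] using hgy i
    obtain ⟨j, hj⟩ : ∃ j, M 0 (Pi.single j 1) ≠ 0 := by
      by_contra! hall
      refine hM (LinearMap.pi_ext' fun j => LinearMap.ext_ring ?_)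
      simpa using hall j
    obtain ⟨c, hc⟩ := hst j
    let S : Submodule (ZMod 2) Q := Submodule.span (ZMod 2) {M 0 (Pi.single j 1)}
    by_cases hcons : ∃ y : Fin n → Cube m,
        ∑ i, (S.mkQ ∘ₗ M i.succ) (y i) = S.mkQ (b - M 0 c)
    · -- All coordinates of the first block but `j` are set to those of `c`; coordinate `j` stays
      -- free to absorb one equation.
      obtain ⟨J, z, hJ, h⟩ := ih (Q ⧸ S) (fun i => S.mkQ ∘ₗ M i.succ) _ hcons
      refine ⟨g c, J, z, ?_, fun w hw => ?_⟩
      · have h1 := S.finrank_quotient_add_finrank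
        have h2 : Module.finrank (ZMod 2) S = 1 := finrank_span_singleton hj
        omega
      · obtain ⟨y, hy, hgy⟩ := h w hw
        have hmem : b - M 0 c - ∑ i : Fin n, M i.succ (y i) ∈ S := by
          rw [← Submodule.Quotient.mk_eq_zero, ← Submodule.mkQ_apply, map_sub, ← hy, map_sum]
          simp
        obtain ⟨t, ht⟩ := Submodule.mem_span_singleton.mp hmem
        refine ⟨c + Pi.single j t, y, ?_, hc t, hgy⟩
        have hsingle : (Pi.single j t : Cube m) = t • Pi.single j 1 := by
          rw [← Pi.single_smul, smul_eq_mul, mul_one]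
        rw [map_add, hsingle, map_smul, ht]
        abel
    · -- That assignment is inconsistent, so the other blocks do not reach all of `Q`; committing the
      -- whole first block to a solution leaves a system with values in a proper subspace.
      let L : (Fin n → Cube m) →ₗ[ZMod 2] Q := ∑ i, M i.succ ∘ₗ LinearMap.proj i
      have hL (y : Fin n → Cube m) : L y = ∑ i : Fin n, M i.succ (y i) := by simp [L]
      have hmem (i : Fin n) (u : Cube m) : M i.succ u ∈ LinearMap.range L := by
        refine ⟨Pi.single i u, ?_⟩
        rw [hL, Finset.sum_eq_single i]
        · simp
        · intro i' _ hi'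
          simp [Pi.single_eq_of_ne hi']
        · simp
      have hlt : Module.finrank (ZMod 2) (LinearMap.range L) < Module.finrank (ZMod 2) Q := by
        refine Submodule.finrank_lt fun htop => hcons ?_
        obtain ⟨y, hy⟩ : b - M 0 c ∈ LinearMap.range L := htop ▸ Submodule.mem_top
        exact ⟨y, by rw [← hy, hL, map_sum]; rfl⟩
      obtain ⟨y, hy⟩ := hb
      rw [Fin.sum_univ_succ] at hy
      have hsol : L (Fin.tail y) = b - M 0 (y 0) := by
        rw [hL, ← hy]
        simp [Fin.tail]
      have hiff (y' : Fin n → Cube m) :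
          ∑ i : Fin n, (M i.succ).codRestrict (LinearMap.range L) (hmem i) (y' i)
            = ⟨b - M 0 (y 0), _, hsol⟩ ↔ M 0 (y 0) + ∑ i : Fin n, M i.succ (y' i) = b := by
        rw [Subtype.ext_iff, AddSubmonoidClass.coe_finsetSum]
        simp only [LinearMap.codRestrict_apply]
        rw [eq_sub_iff_add_eq']
      obtain ⟨J, z, hJ, h⟩ := ih (LinearMap.range L)
        (fun i => (M i.succ).codRestrict (LinearMap.range L) (hmem i)) ⟨b - M 0 (y 0), _, hsol⟩
        ⟨Fin.tail y, (hiff _).mpr hy⟩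
      refine ⟨g (y 0), J, z, by omega, fun w hw => ?_⟩
      obtain ⟨y', hy', hgy'⟩ := h w hw
      exact ⟨y 0, y', (hiff y').mp hy', rfl, hgy'⟩

/-- A parity certificate of `G = F ∘ g` (up to the indexing `e` of the variables) yields an ordinary
certificate of `F` of at most the same size. -/
theorem exists_certificate_of_affineSubspace {n m N : ℕ} {F : BoolFn n} {g : BoolFn m}
    {G : BoolFn N} (hg : Function.Surjective g)
    (hst : ∀ j, ∃ c : Cube m, ∀ t, g (c + Pi.single j t) = g c) (e : Fin n × Fin m ≃ Fin N)
    (hG : ∀ y, G y = F fun i => g fun a => y (e (i, a)))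
    {H : AffineSubspace (ZMod 2) (Cube N)} {x : Cube N} (hx : x ∈ H) (hH : ∀ y ∈ H, G y = G x) :
    ∃ (J : Finset (Fin n)) (z : Cube n), J.card ≤ codim H ∧
      ∀ w : Cube n, (∀ i ∈ J, w i = z i) → F w = G x := by
  let E : (Fin n → Cube m) →ₗ[ZMod 2] Cube N :=
    { toFun := fun y p => y (e.symm p).1 (e.symm p).2
      map_add' := fun _ _ => rfl
      map_smul' := fun _ _ => rfl }
  let M (i : Fin n) : Cube m →ₗ[ZMod 2] Cube N ⧸ H.direction :=
    H.direction.mkQ ∘ₗ E ∘ₗ LinearMap.single (ZMod 2) (fun _ => Cube m) i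
  have hM (y : Fin n → Cube m) : ∑ i, M i (y i) = H.direction.mkQ (E y) := by
    conv_rhs => rw [← Finset.univ_sum_single y]
    simp [M, map_sum]
  obtain ⟨J, z, hJ, h⟩ := exists_subcube_of_linear_system hg hst n _ M (H.direction.mkQ x)
    ⟨fun i a => x (e (i, a)), by rw [hM]; congr 1; funext p; simp [E]⟩
  refine ⟨J, z, hJ, fun w hw => ?_⟩
  obtain ⟨y, hy, hgy⟩ := h w hw
  have hmem : E y ∈ H := by
    rw [hM, Submodule.mkQ_apply, Submodule.mkQ_apply, Submodule.Quotient.eq] at hy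
    simpa using AffineSubspace.vadd_mem_of_mem_direction hy hx
  rw [← hH _ hmem, hG]
  congr 1
  funext i
  rw [← hgy i]
  simp [E]

/-! ### Certificates of the powers of `sort` -/

theorem sort_irrelevant (j : Fin 4) : ∃ c : Cube 4, ∀ t, sort (c + Pi.single j t) = sort c := by
  fin_cases j
  · exact ⟨![0, 1, 0, 1], by decide⟩
  · exact ⟨![0, 0, 1, 0], by decide⟩
  · exact ⟨![0, 1, 0, 0], by decide⟩
  · exact ⟨![1, 0, 1, 0], by decide⟩

/-- Ordinary certificates of `sort` have size at least three. -/
theorem exists_sort_eq {B : Finset (Fin 4)} (hB : B.card ≤ 2) (z : Cube 4) (b : ZMod 2) :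
    ∃ w : Cube 4, (∀ i ∈ B, w i = z i) ∧ sort w = b := by
  revert B z b
  decide

theorem sort_surjective : Function.Surjective sort := fun b =>
  let ⟨w, _, hw⟩ := exists_sort_eq (B := ∅) (by simp) 0 b
  ⟨w, hw⟩

/-- Ordinary certificates of the `k`-th power of `sort` have size at least `3 ^ k`. -/
theorem exists_power_sort_eq (k : ℕ) {J : Finset (Fin (4 ^ k))} (hJ : J.card < 3 ^ k)
    (z : Cube (4 ^ k)) (b : ZMod 2) :
    ∃ w : Cube (4 ^ k), (∀ i ∈ J, w i = z i) ∧ power sort k w = b := by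
  induction k generalizing b with
  | zero =>
    have : J = ∅ := by simpa using hJ
    exact ⟨fun _ => b, by simp [this], rfl⟩
  | succ k ih =>
    let e : Fin 4 × Fin (4 ^ k) ≃ Fin (4 ^ (k + 1)) := blockIndex 4 (4 ^ k)
    let K (i : Fin 4) : Finset (Fin (4 ^ k)) := Finset.univ.filter fun a => e (i, a) ∈ J
    let B : Finset (Fin 4) := Finset.univ.filter fun i => 3 ^ k ≤ (K i).card
    have hsum : ∑ i, (K i).card = J.card := by
      have h : J = (Finset.univ.sigma K).map
          ((Equiv.sigmaEquivProd _ _).trans e).toEmbedding := by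
        ext p
        obtain ⟨⟨i, a⟩, rfl⟩ := e.surjective p
        simp [K]
      conv_rhs => rw [h]
      simp
    have hB : B.card ≤ 2 := by
      by_contra! hlt
      have h1 : B.card * 3 ^ k ≤ ∑ i ∈ B, (K i).card := by
        rw [← smul_eq_mul]
        exact Finset.card_nsmul_le_sum _ _ _ fun i hi => by simpa [B] using hi
      have h2 : ∑ i ∈ B, (K i).card ≤ ∑ i, (K i).card :=
        Finset.sum_le_sum_of_subset (Finset.subset_univ _)
      have h3 : 3 * 3 ^ k ≤ B.card * 3 ^ k := Nat.mul_le_mul_right _ hlt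
      have h4 : 3 ^ (k + 1) = 3 * 3 ^ k := pow_succ' 3 k
      omega
    obtain ⟨v, hv, hvb⟩ := exists_sort_eq hB (fun i => power sort k fun a => z (e (i, a))) b
    -- Blocks in `B` copy `z`; every other block realises its prescribed value of the inner power.
    have hblock (i : Fin 4) : ∃ w : Cube (4 ^ k), (∀ a ∈ K i, w a = z (e (i, a))) ∧
        power sort k w = v i := by
      by_cases hi : i ∈ B
      · exact ⟨_, fun _ _ => rfl, (hv i hi).symm⟩
      · exact ih (by simpa [B] using hi) (fun a => z (e (i, a))) (v i)
    choose w hwz hwv using hblock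
    refine ⟨fun p => w (e.symm p).1 (e.symm p).2, fun p hp => ?_, ?_⟩
    · obtain ⟨⟨i, a⟩, rfl⟩ := e.surjective p
      simpa using hwz i a (by simpa [K] using hp)
    · rw [← hvb]
      change sort (fun i => power sort k fun a =>
        w (e.symm (e (i, a))).1 (e.symm (e (i, a))).2) = sort v
      simp only [Equiv.symm_apply_apply, hwv]

/-- The `k + 1`-st power of `f` is also the `k`-th power composed with `f` on the inside, up to the
indexing of the variables. -/
theorem exists_power_succ_eq {n : ℕ} (f : BoolFn n) (k : ℕ) :
    ∃ e : Fin (n ^ k) × Fin n ≃ Fin (n ^ (k + 1)), ∀ y : Cube (n ^ (k + 1)),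
      power f (k + 1) y = power f k fun i => f fun a => y (e (i, a)) := by
  induction k with
  | zero =>
    have : Unique (Fin (n ^ 0)) := inferInstanceAs (Unique (Fin 1))
    refine ⟨(Equiv.prodComm _ _).trans (blockIndex n (n ^ 0)), fun y => ?_⟩
    change f _ = f _
    congr 1
  | succ k ih =>
    obtain ⟨e, he⟩ := ih
    refine ⟨((blockIndex n (n ^ k)).symm.prodCongr (Equiv.refl _)).trans <|
      (Equiv.prodAssoc _ _ _).trans <|
      ((Equiv.refl _).prodCongr e).trans (blockIndex n (n ^ (k + 1))), fun y => ?_⟩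
    change f (fun i => power f (k + 1) fun a => y (blockIndex n (n ^ (k + 1)) (i, a)))
      = f fun i => power f k fun s => _
    congr 1
    funext i
    rw [he]
    congr 1
    funext s
    congr 1
    funext a
    change _ = y (blockIndex n (n ^ (k + 1))
      (((blockIndex n (n ^ k)).symm (blockIndex n (n ^ k) (i, s))).1,
        e (((blockIndex n (n ^ k)).symm (blockIndex n (n ^ k) (i, s))).2, a)))
    rw [Equiv.symm_apply_apply]

theorem le_minParityCert {n d : ℕ} {f : BoolFn n}
    (h : ∀ (H : AffineSubspace (ZMod 2) (Cube n)) (x : Cube n), x ∈ H → (∀ y ∈ H, f y = f x) →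
      d ≤ codim H) : d ≤ minParityCert f := by
  refine le_ciInf fun x => le_csInf ?_ ?_
  · exact ⟨_, AffineSubspace.mk' x ⊥, AffineSubspace.self_mem_mk' _ _, fun y hy => by
      rw [AffineSubspace.mem_mk', Submodule.mem_bot, vsub_eq_sub, sub_eq_zero] at hy
      rw [hy], rfl⟩
  · rintro _ ⟨H, hx, hH, rfl⟩
    exact h H x hx hH

theorem three_pow_le_minParityCert (k : ℕ) : 3 ^ k ≤ minParityCert (power sort (k + 1)) := by
  refine le_minParityCert fun H x hx hH => ?_
  by_contra! hlt
  obtain ⟨e, he⟩ := exists_power_succ_eq sort k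
  obtain ⟨J, z, hJ, h⟩ :=
    exists_certificate_of_affineSubspace sort_surjective sort_irrelevant e he hx hH
  obtain ⟨w, hw, hwv⟩ := exists_power_sort_eq k (hJ.trans_lt hlt) z (power sort (k + 1) x + 1)
  have := h w hw
  rw [hwv] at this
  simp at this

end BoolPower

theorem corollary9 :
    (∃ c : ℝ, 0 < c ∧ ∀ k : ℕ, 1 ≤ k →
      c * (Real.logb 2 (BoolPower.sparsity (BoolPower.power BoolPower.sort k) : ℝ)) ^
          (Real.logb 2 3)
        ≤ (BoolPower.minParityCert (BoolPower.power BoolPower.sort k) : ℝ)) ∧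
    (∃ c : ℝ, 0 < c ∧ ∀ k : ℕ, 1 ≤ k →
      c * (Real.logb 2 (BoolPower.spectralNorm (BoolPower.power BoolPower.sort k))) ^
          (Real.logb 2 3)
        ≤ (BoolPower.minParityCert (BoolPower.power BoolPower.sort k) : ℝ)) ∧
    (∃ c C : ℝ, 0 < c ∧ 0 < C ∧ ∀ k : ℕ, 1 ≤ k →
      c * (Real.logb 2 (BoolPower.spectralNorm (BoolPower.power BoolPower.sort k))) ^
          (Real.logb 2 3)
        ≤ (Real.logb 2 (BoolPower.sparsity (BoolPower.power BoolPower.sort k) : ℝ)) ^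
          (Real.logb 2 3) ∧
      (Real.logb 2 (BoolPower.sparsity (BoolPower.power BoolPower.sort k) : ℝ)) ^
          (Real.logb 2 3)
        ≤ C * (Real.logb 2 (BoolPower.spectralNorm (BoolPower.power BoolPower.sort k))) ^
          (Real.logb 2 3)) := by
  have hp : 0 ≤ Real.logb 2 3 := Real.logb_nonneg one_lt_two (by norm_num)
  have h2p : (2 : ℝ) ^ Real.logb 2 3 = 3 :=
    Real.rpow_logb two_pos (by norm_num) (by norm_num)
  have hpos (k : ℕ) : (0 : ℝ) ≤ 2 ^ k - 1 := sub_nonneg.mpr (one_le_pow₀ one_le_two)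
  have hmul (k : ℕ) : (2 * ((2 : ℝ) ^ k - 1)) ^ Real.logb 2 3
      = 3 * ((2 : ℝ) ^ k - 1) ^ Real.logb 2 3 := by
    rw [Real.mul_rpow two_pos.le (hpos k), h2p]
  have hle (k : ℕ) (hk : 1 ≤ k) : ((2 : ℝ) ^ k - 1) ^ Real.logb 2 3
      ≤ 3 * BoolPower.minParityCert (BoolPower.power BoolPower.sort k) := by
    obtain ⟨k, rfl⟩ := Nat.exists_eq_add_of_le' hk
    calc ((2 : ℝ) ^ (k + 1) - 1) ^ Real.logb 2 3
        ≤ ((2 : ℝ) ^ (k + 1)) ^ Real.logb 2 3 :=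
          Real.rpow_le_rpow (hpos _) (by linarith) hp
      _ = 3 * 3 ^ k := by
          rw [← Real.rpow_natCast, ← Real.rpow_mul two_pos.le, mul_comm, Real.rpow_mul two_pos.le,
            h2p, Real.rpow_natCast, pow_succ, mul_comm]
      _ ≤ _ := by
          gcongr
          exact_mod_cast BoolPower.three_pow_le_minParityCert k
  simp only [fun k => (BoolPower.logb_sparsity_spectralNorm k).1,
    fun k => (BoolPower.logb_sparsity_spectralNorm k).2, hmul]
  refine ⟨⟨1 / 9, by norm_num, fun k hk => ?_⟩, ⟨1 / 3, by norm_num, fun k hk => ?_⟩,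
    1, 3, one_pos, three_pos, fun k _ => ⟨?_, le_rfl⟩⟩
  · linarith [hle k hk]
  · linarith [hle k hk]
  · linarith [Real.rpow_nonneg (hpos k) (Real.logb 2 3)]
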